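/- All systems are finite-dimensional with a fixed computational basis, states are density matrices, $\Delta$ is the completely dephasing map in the computational basis, logarithms are base $2$, and $P(\rho,\sigma)=\sqrt{1-F(\rho,\sigma)^2}$ with $F(\rho,\sigma)=\|\sqrt\rho\sqrt\sigma\|_1+\sqrt{(1-\operatorname{tr}\rho)(1-\operatorname{tr}\sigma)}$ is the purified distance. A state is incoherent if it is diagonal. A quantum operation (completely positive trace-preserving map) $\Lambda$ is in MIO if it maps incoherent states to incoherent states; in DIO if $\Delta\circ\Lambda=\Lambda\circ\Delta$; in IO if it has Kraus operators $K_l$ such that $K_l\rho K_l^\dagger$ is diagonal and positive semidefinite for all $l$ and all incoherent $\rho$; and $\mathrm{DIIO}=\mathrm{DIO}\cap\mathrm{IO}$. Let $\rho_B$ be a state, $\varepsilon\in[0,1]$ and $\mathcal O\in\{\mathrm{MIO},\mathrm{DIO},\mathrm{IO},\mathrm{DIIO}\}$. The one-shot distillable coherence is $$C_{d,\mathcal O}^{\varepsilon}(\rho_B)=\sup\{\log|C| : P(\Lambda_{B\to C}(\rho_B),\Psi_C)\le\varepsilon,\ \Lambda\in\mathcal O\},$$ where $\Psi_C$ is the projector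 onto $|C|^{-1/2}\sum_{c}|c\rangle$. Fix any purification $|\psi\rangle_{BR}$ of $\rho_B$ and, for every operation $\Lambda_{B\to C}$, any Stinespring isometry $U^\Lambda:B\to C\otimes E$ with $\Lambda(X)=\operatorname{tr}_E U^\Lambda X (U^\Lambda)^\dagger$. For a function $f$ from the basis labels of $C$ to those of a system $L$, let $\rho[\Lambda,\Delta,f]_{LER}=\sum_c |f(c)\rangle\langle f(c)|_L\otimes\langle c|_C\, U^\Lambda|\psi\rangle\langle\psi|(U^\Lambda)^\dagger\,|c\rangle_C$. Eve holds $E$ and $R$, and security is measured by $d_{sec}(\omega_{LER}|ER)=\inf_{\sigma_{ER}}P(\omega_{LER},\pi_L\otimes\sigma_{ER})$, where $\sigma_{ER}$ runs over states and $\pi_L$ is the completely mixed state. The one-shot incoherent extractable randomness is $$\ell_{\mathcal O}^{\varepsilon}(\rho_B)=\sup_{\Lambda\in\mathcal O}\ \sup_f\{\log|L| : d_{sec}(\rho[\Lambda,\Delta,f]_{LER}|ER)\le\varepsilon\}.$$ Then $$C_{d,\mathcal O}^{\varepsilon}(\rho_B)=\ell_{\mathcal O}^{\varepsilon}(\rho_B)$$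 as elements of the extended reals, whatever purification and Stinespring isometries are chosen. Moreover, if $\varepsilon<1$, then both suprema are attained: $C_{d,\mathcal O}^{\varepsilon}(\rho_B)$ by some $\Lambda\in\mathcal O$, and $\ell_{\mathcal O}^{\varepsilon}(\rho_B)$ by some $\Lambda\in\mathcal O$ and some $f$. -/

import Mathlib

open scoped Matrix MatrixOrder ComplexOrder Kronecker

noncomputable section

namespace Coherence

/-! Finite quantum systems are represented by finite index types: the index type `B` of a system labels
its computational basis, and operators on the system are matrices in that basis. -/

/-- Quantum states (density matrices). -/
def IsState {B : Type*} [Fintype B] (ρ : Matrix B B ℂ) : Prop :=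
  ρ.PosSemidef ∧ ρ.trace = 1

/-- The density operator `|v⟩⟨v|` of a vector. -/
def ketbra {B : Type*} (v : B → ℂ) : Matrix B B ℂ :=
  Matrix.vecMulVec v (star v)

/-- Partial trace over the second system. -/
def traceRight {B R : Type*} [Fintype R] (M : Matrix (B × R) (B × R) ℂ) : Matrix B B ℂ :=
  Matrix.of fun b b' => ∑ r, M (b, r) (b', r)

/-- `ψ` is (the coordinate vector of) a purification of `ρ`. -/
def IsPurification {B R : Type*} [Fintype R] (ψ : B × R → ℂ) (ρ : Matrix B B ℂ) : Prop :=
  traceRight (ketbra ψ) = ρ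

/-! ### Fidelity and purified distance -/

/-- The trace norm `‖A‖₁ = tr √(Aᴴ A)`. -/
def traceNorm {B : Type*} [Fintype B] [DecidableEq B] (A : Matrix B B ℂ) : ℝ :=
  (CFC.sqrt (Aᴴ * A)).trace.re

/-- Generalized fidelity. -/
def fidelity {B : Type*} [Fintype B] [DecidableEq B] (ρ σ : Matrix B B ℂ) : ℝ :=
  traceNorm (CFC.sqrt ρ * CFC.sqrt σ) + √((1 - ρ.trace.re) * (1 - σ.trace.re))

/-- Purified distance. -/
def purifiedDist {B : Type*} [Fintype B] [DecidableEq B] (ρ σ : Matrix B B ℂ) : ℝ :=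
  √(1 - fidelity ρ σ ^ 2)

/-! ### Quantum operations and free operations -/

/-- Complete positivity: `Λ ⊗ id_k` is positive for every `k`. -/
def IsCompletelyPositive {B C : Type*} (Λ : Matrix B B ℂ →ₗ[ℂ] Matrix C C ℂ) : Prop :=
  ∀ (k : ℕ) (X : Matrix (B × Fin k) (B × Fin k) ℂ), X.PosSemidef →
    (Matrix.of fun x y : C × Fin k =>
      Λ (Matrix.of fun b b' => X (b, x.2) (b', y.2)) x.1 y.1).PosSemidef

/-- Quantum operations: completely positive trace-preserving maps. -/
structure Channel (B C : Type*) [Fintype B] [Fintype C] where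
  map : Matrix B B ℂ →ₗ[ℂ] Matrix C C ℂ
  completelyPositive : IsCompletelyPositive map
  tracePreserving : ∀ X, (map X).trace = X.trace

/-- The completely dephasing map in the computational basis. -/
def dephase {B : Type*} [DecidableEq B] (X : Matrix B B ℂ) : Matrix B B ℂ :=
  Matrix.diagonal X.diag

/-- Incoherent states. -/
def IsIncoherentState {B : Type*} [Fintype B] [DecidableEq B] (ρ : Matrix B B ℂ) : Prop :=
  IsState ρ ∧ ρ = dephase ρ

/-- Maximally incoherent operations. -/
def IsMIO {B C : Type*} [Fintype B] [DecidableEq B] [Fintype C] [DecidableEq C]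
    (Λ : Channel B C) : Prop :=
  ∀ ρ, IsIncoherentState ρ → IsIncoherentState (Λ.map ρ)

/-- Dephasing-covariant incoherent operations. -/
def IsDIO {B C : Type*} [Fintype B] [DecidableEq B] [Fintype C] [DecidableEq C]
    (Λ : Channel B C) : Prop :=
  ∀ X, dephase (Λ.map X) = Λ.map (dephase X)

/-- Incoherent operations: there is a Kraus representation by operators each of which maps incoherent
states to diagonal positive semidefinite operators. -/
def IsIncoherentOp {B C : Type*} [Fintype B] [DecidableEq B] [Fintype C] [DecidableEq C]
    (Λ : Channel B C) : Prop :=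
  ∃ (k : ℕ) (K : Fin k → Matrix C B ℂ),
    (∀ X, Λ.map X = ∑ l, K l * X * (K l)ᴴ) ∧
    ∀ (l : Fin k) (ρ : Matrix B B ℂ), IsIncoherentState ρ →
      (K l * ρ * (K l)ᴴ).PosSemidef ∧ K l * ρ * (K l)ᴴ = dephase (K l * ρ * (K l)ᴴ)

/-- The names of the four classes of free operations. -/
inductive FreeClass where
  | mio
  | dio
  | io
  | diio

/-- Membership of a quantum operation in a class of free operations. -/
def IsFree {B C : Type*} [Fintype B] [DecidableEq B] [Fintype C] [DecidableEq C]
    (O : FreeClass) (Λ : Channel B C) : Prop :=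
  match O with
  | .mio => IsMIO Λ
  | .dio => IsDIO Λ
  | .io => IsIncoherentOp Λ
  | .diio => IsDIO Λ ∧ IsIncoherentOp Λ

/-! ### Coherence distillation -/

/-- The maximally coherent state: all entries of its density matrix are `1 / |C|`. -/
def maxCoherent (C : Type*) [Fintype C] : Matrix C C ℂ :=
  ketbra fun _ => ((1 / √(Fintype.card C) : ℝ) : ℂ)

/-- The rates `log₂ |C|` that are achievable in coherence distillation with error `ε`. -/
def distillationRates {B : Type*} [Fintype B] [DecidableEq B] (O : FreeClass) (ε : ℝ)
    (ρ : Matrix B B ℂ) : Set EReal :=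
  {x | ∃ (n : ℕ) (Λ : Channel B (Fin n)), IsFree O Λ ∧
    purifiedDist (Λ.map ρ) (maxCoherent (Fin n)) ≤ ε ∧ x = (Real.logb 2 n : ℝ)}

/-- One-shot distillable coherence, with values in the extended reals. -/
def distillableCoherence {B : Type*} [Fintype B] [DecidableEq B] (O : FreeClass) (ε : ℝ)
    (ρ : Matrix B B ℂ) : EReal :=
  sSup (distillationRates O ε ρ)

/-! ### Incoherent randomness extraction -/

/-- A Stinespring representation of `Λ`: an isometry `U` from `B` to `C ⊗ E` with
`Λ X = tr_E (U X Uᴴ)`. The environment `E` has the basis `Fin envDim`. -/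
structure Stinespring {B C : Type*} [Fintype B] [DecidableEq B] [Fintype C]
    (Λ : Channel B C) where
  envDim : ℕ
  U : Matrix (C × Fin envDim) B ℂ
  isometry : Uᴴ * U = 1
  map_eq : ∀ X, Λ.map X = traceRight (U * X * Uᴴ)

/-- Every quantum operation has a Stinespring representation. -/
theorem Stinespring.nonempty {B C : Type*} [Fintype B] [DecidableEq B] [Fintype C] [DecidableEq C] (Λ : Channel B C) :
    Nonempty (Stinespring Λ) := by
  classical
  let k := Fintype.card B
  let e : B ≃ Fin k := Fintype.equivFin B
  let v : B × Fin k → ℂ := fun x => if e x.1 = x.2 then 1 else 0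
  have h1 := Λ.completelyPositive k (Matrix.vecMulVec v (star v)) (Matrix.posSemidef_vecMulVec_self_star v)
  set J := (Matrix.of fun x y : C × Fin k =>
      Λ.map (Matrix.of fun b b' => (Matrix.vecMulVec v (star v)) (b, x.2) (b', y.2)) x.1 y.1) with hJ
  obtain ⟨A, hA⟩ := (CStarAlgebra.nonneg_iff_eq_star_mul_self (a := J)).1 (Matrix.nonneg_iff_posSemidef.2 h1); rw [Matrix.star_eq_conjTranspose] at hA
  have hs : ∀ b b', Λ.map (Matrix.single b b' 1) = Matrix.of fun c c' => J (c, e b) (c', e b') := by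
    intro b b'
    have hE : Matrix.single b b' (1:ℂ) = Matrix.of fun x y =>
        (Matrix.vecMulVec v (star v)) (x, e b) (y, e b') := by
      ext x y
      by_cases h : b = x <;> by_cases h' : b' = y <;>
        simp [v, Matrix.vecMulVec_apply, h, h', eq_comm]
    rw [hE]
    rfl
  let g : Fin (Fintype.card (C × Fin k)) ≃ C × Fin k := (Fintype.equivFin _).symm
  let U : Matrix (C × Fin (Fintype.card (C × Fin k))) B ℂ :=
    Matrix.of fun x b => star (A (g x.2) (x.1, e b))
  have hU : ∀ X, Λ.map X = traceRight (U * X * Uᴴ) := by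
    intro X
    have hX := Matrix.matrix_eq_sum_single X
    have : Λ.map X = ∑ b, ∑ b', X b b' • Λ.map (Matrix.single b b' 1) := by
      conv_lhs => rw [hX]
      simp only [map_sum]
      refine Finset.sum_congr rfl fun b _ => Finset.sum_congr rfl fun b' _ => ?_
      rw [← map_smul, Matrix.smul_single, smul_eq_mul, mul_one]
    rw [this]
    ext c c'
    simp only [Matrix.sum_apply, Matrix.smul_apply, hs, Matrix.of_apply, hA, traceRight, U,
      Matrix.mul_apply, Matrix.conjTranspose_apply, star_star, smul_eq_mul, Finset.sum_mul, Finset.mul_sum]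
    rw [Finset.sum_comm]
    rw [Finset.sum_comm (s := (Finset.univ : Finset (Fin _)))]
    refine Finset.sum_congr rfl fun b _ => ?_
    rw [Finset.sum_comm (s := (Finset.univ : Finset (Fin _)))]
    refine Finset.sum_congr rfl fun b' _ => ?_
    rw [← g.sum_comp]
    refine Finset.sum_congr rfl fun b' _ => ?_
    ring
  refine ⟨⟨_, U, ?_, hU⟩⟩
  ext b b'
  have h2 := Λ.tracePreserving (Matrix.single b' b (1:ℂ))
  rw [hU] at h2
  have h3 : (traceRight (U * Matrix.single b' b (1:ℂ) * Uᴴ)).trace = (Uᴴ * U) b b' := by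
    have : (traceRight (U * Matrix.single b' b (1:ℂ) * Uᴴ)).trace = (U * Matrix.single b' b (1:ℂ) * Uᴴ).trace := by
      simp only [traceRight, Matrix.trace, Fintype.sum_prod_type, Matrix.diag, Matrix.of_apply]
    rw [this, Matrix.mul_assoc, Matrix.trace_mul_comm, Matrix.mul_assoc, Matrix.trace_single_mul]
    simp
  rw [← h3, h2, Matrix.one_apply, Matrix.trace]
  by_cases h : b = b' <;> simp [Matrix.single_apply, h, Matrix.diag]

/-- The vector `(U ⊗ 1_R) |ψ⟩` of the systems `C`, `E` and `R`. -/
def applyIsometry {B C E R : Type*} [Fintype B] (U : Matrix (C × E) B ℂ) (ψ : B × R → ℂ) :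
    C × (E × R) → ℂ :=
  fun x => ∑ b, U (x.1, x.2.1) b * ψ (b, x.2.2)

/-- Complete dephasing of the first of two systems. -/
def dephaseLeft {C R : Type*} [DecidableEq C] (M : Matrix (C × R) (C × R) ℂ) :
    Matrix (C × R) (C × R) ℂ :=
  Matrix.of fun x y => if x.1 = y.1 then M x y else 0

/-- The action of a function `f` on the classical first system:
`∑ c, |c⟩⟨c| ⊗ M_c` becomes `∑ c, |f c⟩⟨f c| ⊗ M_c`. -/
def hashLeft {C L R : Type*} [Fintype C] [DecidableEq L] (f : C → L)
    (M : Matrix (C × R) (C × R) ℂ) : Matrix (L × R) (L × R) ℂ :=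
  ∑ c, Matrix.single (f c) (f c) (1 : ℂ) ⊗ₖ (Matrix.of fun r r' => M (c, r) (c, r'))

/-- The completely mixed state. -/
def maxMixed (L : Type*) [Fintype L] [DecidableEq L] : Matrix L L ℂ :=
  (Fintype.card L : ℂ)⁻¹ • 1

/-- The distance of a bipartite state from the states `π ⊗ σ` with `π` completely mixed and `σ` any
state of the second system. -/
def dSec {L R : Type*} [Fintype L] [DecidableEq L] [Fintype R] [DecidableEq R]
    (ω : Matrix (L × R) (L × R) ℂ) : ℝ :=
  sInf {d | ∃ σ : Matrix R R ℂ, IsState σ ∧ d = purifiedDist ω (maxMixed L ⊗ₖ σ)}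

/-- The state of `L`, `E`, `R` at the end of the protocol: `Λ` is performed through its Stinespring
isometry on the purification `ψ`, then `C` is dephased, and then `f` is applied. -/
def protocolOutput {B C L R : Type*} [Fintype B] [DecidableEq B] [Fintype C] [DecidableEq C]
    [DecidableEq L] {Λ : Channel B C} (S : Stinespring Λ) (f : C → L) (ψ : B × R → ℂ) :
    Matrix (L × (Fin S.envDim × R)) (L × (Fin S.envDim × R)) ℂ :=
  hashLeft f (dephaseLeft (ketbra (applyIsometry S.U ψ)))

/-- The rates `log₂ |L|` of `ε`-secure randomness that are achievable by the operation `Λ`; Eve holds the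
environment of `Λ` and the purifying system of `ψ`. -/
def extractionRates {B C R : Type*} [Fintype B] [DecidableEq B] [Fintype C] [DecidableEq C]
    [Fintype R] [DecidableEq R] {Λ : Channel B C} (S : Stinespring Λ) (ε : ℝ)
    (ψ : B × R → ℂ) : Set EReal :=
  {x | ∃ (m : ℕ) (f : C → Fin m), dSec (protocolOutput S f ψ) ≤ ε ∧ x = (Real.logb 2 m : ℝ)}

/-- One-shot extractable randomness under a given operation. -/
def extractableRandomnessOf {B C R : Type*} [Fintype B] [DecidableEq B] [Fintype C]
    [DecidableEq C] [Fintype R] [DecidableEq R] {Λ : Channel B C} (S : Stinespring Λ) (ε : ℝ)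
    (ψ : B × R → ℂ) : EReal :=
  sSup (extractionRates S ε ψ)

/-- One-shot extractable randomness under a class of free operations, where `ψ` is the purification of
Bob's state and `S` gives the Stinespring representation that is used for each operation. -/
def extractableRandomness {B R : Type*} [Fintype B] [DecidableEq B] [Fintype R] [DecidableEq R]
    (O : FreeClass) (ε : ℝ) (ψ : B × R → ℂ)
    (S : ∀ (n : ℕ) (Λ : Channel B (Fin n)), Stinespring Λ) : EReal :=
  sSup {x | ∃ (n : ℕ) (Λ : Channel B (Fin n)), IsFree O Λ ∧
    x = extractableRandomnessOf (S n Λ) ε ψ}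

end Coherence

end

/-!
For each class of free operations and each error, the integers `n` that are achievable in distillation
and in extraction are the same (`distillationRates_eq`), and everything else follows from this. Let `φ` be the
pure state of `C`, `E`, `R` after the Stinespring isometry of `Λ`, with blocks `φ_c` on `E ⊗ R`, so that
`Λ ρ` is its marginal on `C`.

*From distillation to extraction* (`exists_isState_fidelity_le`). The squared fidelity of `Λ ρ` with the
maximally coherent state is `‖v‖²`, where `v = |C|^(-1/2) ∑ c, φ_c`. With `f = id` and `θ = v / ‖v‖`, the
fidelity of the dephased state with `π ⊗ |θ⟩⟨θ|` is `|C|^(-1/2) ∑ c, |⟨θ, φ_c⟩| ≥ ⟨θ, v⟩ = ‖v‖`.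

*From extraction to distillation* (`exists_hashChannel_fidelity_le`). Let `ω = A Aᴴ` be the state of `L`, `E`,
`R` at the end of the protocol. Its fidelity with `π ⊗ σ` is `tr (W Aᴴ √(π ⊗ σ))` for a contraction `W`, by
polar decomposition. The blocks `⟨l| W`, conjugated entrywise, are again contractions, hence extend to isometries `Z l` of `C`. Bob
applies `Λ`, computes `f` coherently into `L`, applies `Z (f c)` to `C`, and discards the output of `Z`. By
Cauchy–Schwarz, the fidelity of the resulting state with the maximally coherent state of `L` is at least that
of `ω` with `π ⊗ σ`. The postprocessing has Kraus operators that map each basis vector to a multiple of a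
basis vector and commutes with dephasing, whence each of the four classes is stable under it
(`IsFree.hashChannel_comp`). The infimum over `σ` is attained because the set of states is compact and the
matrix square root is continuous (`dSec_le_iff`), so no error is lost.

*Attainment.* For `ε < 1` the achievable set is nonempty, since it contains `n = 1`, and finite: every free
operation is in MIO, and `ρ ≤ d Δ(ρ)` gives `F(Λ ρ, Ψ_n)² ≤ d / n` (`fidelity_map_maxCoherent_sq_le`). Hence
its supremum is a maximum.
-/

namespace Coherence

/-! ### Square roots of matrices, the polar decomposition and the fidelity -/

open scoped Matrix.Norms.L2Operator in
theorem continuousOn_matrix_sqrt {n : Type*} [Fintype n] [DecidableEq n] :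
    ContinuousOn (CFC.sqrt : Matrix n n ℂ → Matrix n n ℂ) {A | A.PosSemidef} := by
  have h := CFC.continuousOn_sqrt (A := Matrix n n ℂ)
  simpa only [Matrix.nonneg_iff_posSemidef] using h

theorem posSemidef_sqrt {n : Type*} [Fintype n] [DecidableEq n] (A : Matrix n n ℂ) :
    (CFC.sqrt A).PosSemidef :=
  Matrix.nonneg_iff_posSemidef.1 (CFC.sqrt_nonneg A)

theorem sqrt_mul_sqrt {n : Type*} [Fintype n] [DecidableEq n] {A : Matrix n n ℂ}
    (hA : A.PosSemidef) : CFC.sqrt A * CFC.sqrt A = A :=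
  CFC.sqrt_mul_sqrt_self A (Matrix.nonneg_iff_posSemidef.2 hA)

theorem sqrt_eq_of_mul_self {n : Type*} [Fintype n] [DecidableEq n] {A B : Matrix n n ℂ}
    (h : B * B = A) (hB : B.PosSemidef) : CFC.sqrt A = B :=
  CFC.sqrt_unique h (Matrix.nonneg_iff_posSemidef.2 hB)

/-- Polar decomposition: `√(Mᴴ M) = W M` for a contraction `W`. The witness is `W = g(Mᴴ M) Mᴴ` with
`g(t) = t ^ (-1/2)` for `t > 0` and `g(0) = 0`; it is a partial isometry. -/
theorem exists_contraction_mul_eq_sqrt {p q : Type*} [Fintype p] [DecidableEq p] [Fintype q]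
    [DecidableEq q] (M : Matrix q p ℂ) :
    ∃ W : Matrix p q ℂ, (1 - Wᴴ * W).PosSemidef ∧ W * M = CFC.sqrt (Mᴴ * M) := by
  have hH : (Mᴴ * M).PosSemidef := Matrix.posSemidef_conjTranspose_mul_self M
  set H := Mᴴ * M with hHdef
  have hsa : IsSelfAdjoint H := hH.isHermitian
  have hfin : (spectrum ℝ H).Finite := Matrix.finite_real_spectrum
  have hc : ∀ f : ℝ → ℝ, ContinuousOn f (spectrum ℝ H) := fun f => hfin.continuousOn f
  have hnn : ∀ t ∈ spectrum ℝ H, 0 ≤ t := fun t ht =>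
    spectrum_nonneg_of_nonneg (Matrix.nonneg_iff_posSemidef.2 hH) ht
  set g : ℝ → ℝ := fun t => (√t)⁻¹
  set G := cfc g H with hG
  have hGsa : Gᴴ = G := (cfc_predicate g H : IsSelfAdjoint _)
  have hid : cfc (fun t : ℝ => t) H = H := cfc_id' ℝ H
  have hGH : G * H = cfc Real.sqrt H := by
    have h := cfc_mul g (fun t : ℝ => t) H (hc _) (hc _)
    rw [hid] at h
    rw [hG, ← h]
    refine cfc_congr fun t ht => ?_
    simp only [g]
    rw [← div_eq_inv_mul, Real.div_sqrt]
  have hGG : G * (G * (H * (G * G))) = G * G := by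
    rw [← Matrix.mul_assoc H, ← Matrix.mul_assoc G (H * G), ← Matrix.mul_assoc G H, hGH, hG,
      ← cfc_mul _ _ H (hc _) (hc _), ← cfc_mul _ _ H (hc _) (hc _),
      ← cfc_mul _ _ H (hc _) (hc _), ← cfc_mul _ _ H (hc _) (hc _)]
    refine cfc_congr fun t ht => ?_
    simp only [g]
    by_cases h0 : √t = 0
    · simp [h0]
    · field_simp
  refine ⟨G * Mᴴ, ?_, ?_⟩
  · have hP : (G * Mᴴ)ᴴ * (G * Mᴴ) = M * (G * G) * Mᴴ := by
      simp [Matrix.conjTranspose_mul, hGsa, Matrix.mul_assoc]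
    have hPH : (M * (G * G) * Mᴴ)ᴴ = M * (G * G) * Mᴴ := by
      rw [← hP]; exact Matrix.isHermitian_conjTranspose_mul_self _
    have hPP : (M * (G * G) * Mᴴ) * (M * (G * G) * Mᴴ) = M * (G * G) * Mᴴ := by
      calc _ = M * (G * (G * (H * (G * G)))) * Mᴴ := by simp only [hHdef, Matrix.mul_assoc]
        _ = _ := by rw [hGG]
    rw [hP]
    have : 1 - M * (G * G) * Mᴴ = (1 - M * (G * G) * Mᴴ)ᴴ * (1 - M * (G * G) * Mᴴ) := by
      rw [Matrix.conjTranspose_sub, Matrix.conjTranspose_one, hPH, Matrix.mul_sub, Matrix.sub_mul,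
        Matrix.sub_mul, hPP]
      simp
    rw [this]
    exact Matrix.posSemidef_conjTranspose_mul_self _
  · rw [Matrix.mul_assoc, ← hHdef, hGH]
    symm
    refine sqrt_eq_of_mul_self ?_ ?_
    · rw [← cfc_mul _ _ H (hc _) (hc _)]
      conv_rhs => rw [← hid]
      exact cfc_congr fun t ht => Real.mul_self_sqrt (hnn t ht)
    · exact Matrix.nonneg_iff_posSemidef.1 (cfc_nonneg fun t _ => Real.sqrt_nonneg t)

/-- `√ρ` enters the trace norm only through `ρ`, so that any factorization `ρ = A Aᴴ` may replace it. -/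
theorem traceNorm_sqrt_mul_sqrt {n : Type*} [Fintype n] [DecidableEq n] {ρ : Matrix n n ℂ}
    (hρ : ρ.PosSemidef) (σ : Matrix n n ℂ) :
    traceNorm (CFC.sqrt ρ * CFC.sqrt σ)
      = (CFC.sqrt (CFC.sqrt σ * ρ * CFC.sqrt σ)).trace.re := by
  rw [traceNorm, Matrix.conjTranspose_mul, (posSemidef_sqrt ρ).isHermitian.eq,
    (posSemidef_sqrt σ).isHermitian.eq, Matrix.mul_assoc, ← Matrix.mul_assoc (CFC.sqrt ρ),
    sqrt_mul_sqrt hρ, Matrix.mul_assoc]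

theorem fidelity_eq_of_trace_eq_one {n : Type*} [Fintype n] [DecidableEq n] {ρ σ : Matrix n n ℂ}
    (hρ : ρ.PosSemidef) (hσ : σ.trace = 1) :
    fidelity ρ σ = (CFC.sqrt (CFC.sqrt σ * ρ * CFC.sqrt σ)).trace.re := by
  simp [fidelity, traceNorm_sqrt_mul_sqrt hρ, hσ]

theorem fidelity_nonneg {n : Type*} [Fintype n] [DecidableEq n] (ρ σ : Matrix n n ℂ) :
    0 ≤ fidelity ρ σ :=
  add_nonneg (Complex.nonneg_iff.1 (posSemidef_sqrt _).trace_nonneg).1 (Real.sqrt_nonneg _)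

/-- As `√` is truncated at negative numbers, no bound on the fidelity is needed here. -/
theorem purifiedDist_le_iff {n : Type*} [Fintype n] [DecidableEq n] {ρ σ : Matrix n n ℂ} {ε : ℝ}
    (hε : 0 ≤ ε) : purifiedDist ρ σ ≤ ε ↔ 1 - ε ^ 2 ≤ fidelity ρ σ ^ 2 := by
  rw [purifiedDist, Real.sqrt_le_left hε]
  constructor <;> intro h <;> linarith

/-! ### Channels from Kraus operators, and controlled isometries -/

/-- The channel `X ↦ ∑ i, K i X (K i)ᴴ`. -/
def Channel.ofKraus {B C ι : Type*} [Fintype B] [DecidableEq B] [Fintype C] [Fintype ι]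
    (K : ι → Matrix C B ℂ) (hK : ∑ i, (K i)ᴴ * K i = 1) : Channel B C where
  map :=
    { toFun := fun X => ∑ i, K i * X * (K i)ᴴ
      map_add' := fun X Y => by
        simp only [Matrix.mul_add, Matrix.add_mul, Finset.sum_add_distrib]
      map_smul' := fun a X => by
        simp only [Matrix.mul_smul, Matrix.smul_mul, Finset.smul_sum, RingHom.id_apply] }
  completelyPositive := fun k X hX => by
    have h : (Matrix.of fun x y : C × Fin k =>
        (∑ i, K i * (Matrix.of fun b b' => X (b, x.2) (b', y.2)) * (K i)ᴴ) x.1 y.1)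
        = ∑ i, (K i ⊗ₖ (1 : Matrix (Fin k) (Fin k) ℂ)) * X
            * (K i ⊗ₖ (1 : Matrix (Fin k) (Fin k) ℂ))ᴴ := by
      ext x y
      simp [Matrix.sum_apply, Matrix.mul_apply, Fintype.sum_prod_type, Matrix.one_apply,
        apply_ite (starRingEnd ℂ)]
    exact h ▸ Matrix.posSemidef_sum _ fun i _ => hX.mul_mul_conjTranspose_same _
  tracePreserving := fun X => by
    change (∑ i, K i * X * (K i)ᴴ).trace = X.trace
    simp only [Matrix.trace_sum, Matrix.trace_mul_comm _ (K _)ᴴ]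
    rw [← Matrix.trace_sum]
    simp only [← Matrix.mul_assoc]
    rw [← Matrix.sum_mul, hK, Matrix.one_mul]

theorem Channel.ofKraus_map {B C ι : Type*} [Fintype B] [DecidableEq B] [Fintype C] [Fintype ι]
    (K : ι → Matrix C B ℂ) (hK : ∑ i, (K i)ᴴ * K i = 1) (X : Matrix B B ℂ) :
    (Channel.ofKraus K hK).map X = ∑ i, K i * X * (K i)ᴴ :=
  rfl

/-- Sequential composition: `Λ` is applied first. -/
def Channel.comp {A B C : Type*} [Fintype A] [Fintype B] [Fintype C] (N : Channel B C)
    (Λ : Channel A B) : Channel A C where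
  map := N.map ∘ₗ Λ.map
  completelyPositive := fun k X hX =>
    N.completelyPositive k _ (Λ.completelyPositive k X hX)
  tracePreserving := fun X => (N.tracePreserving _).trans (Λ.tracePreserving X)

/-- The Kraus operators of "compute `f` coherently, then apply the isometry `Z l` controlled by the value
`l = f c`, then discard the output `G` of that isometry". -/
def hashKraus {C L G : Type*} [DecidableEq L] (f : C → L) (Z : L → Matrix G C ℂ) (g : G) :
    Matrix L C ℂ :=
  Matrix.of fun l c => if f c = l then Z l g c else 0

theorem sum_hashKraus {C L G : Type*} [Fintype C] [DecidableEq C] [Fintype L] [DecidableEq L]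
    [Fintype G] (f : C → L) (Z : L → Matrix G C ℂ) (hZ : ∀ l, (Z l)ᴴ * Z l = 1) :
    ∑ g, (hashKraus f Z g)ᴴ * hashKraus f Z g = 1 := by
  ext c c'
  have h := congrFun (congrFun (hZ (f c')) c) c'
  simp only [Matrix.mul_apply, Matrix.conjTranspose_apply] at h
  simp only [Matrix.sum_apply, Matrix.mul_apply, Matrix.conjTranspose_apply, hashKraus,
    Matrix.of_apply, apply_ite star, star_zero, ite_mul, zero_mul, mul_ite, mul_zero,
    Finset.sum_ite_eq, Finset.mem_univ, if_true]
  split_ifs with hf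
  · exact h
  · rw [Matrix.one_apply_ne, Finset.sum_const_zero]
    rintro rfl
    exact hf rfl

/-- The channel that computes `f` coherently, applies `Z (f c)` to `C`, and discards its output; only the
register `L` that holds the value of `f` is kept. It is given by the Kraus operators `hashKraus f Z`. -/
def hashChannel {C L G : Type*} [Fintype C] [DecidableEq C] [Fintype L] [DecidableEq L]
    [Fintype G] (f : C → L) (Z : L → Matrix G C ℂ) (hZ : ∀ l, (Z l)ᴴ * Z l = 1) : Channel C L :=
  Channel.ofKraus (hashKraus f Z) (sum_hashKraus f Z hZ)

theorem dephase_eq_iff {B : Type*} [DecidableEq B] {X : Matrix B B ℂ} :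
    X = dephase X ↔ ∀ i j, i ≠ j → X i j = 0 := by
  constructor
  · intro h i j hij
    rw [h, dephase, Matrix.diagonal_apply_ne _ hij]
  · intro h
    ext i j
    by_cases hij : i = j
    · subst hij; simp [dephase]
    · rw [h i j hij, dephase, Matrix.diagonal_apply_ne _ hij]

theorem hashKraus_mul_mul_apply {C L G : Type*} [Fintype C] [DecidableEq L] (f : C → L)
    (Z : L → Matrix G C ℂ) (g : G) (X : Matrix C C ℂ) (l l' : L) :
    (hashKraus f Z g * X * (hashKraus f Z g)ᴴ) l l'
      = ∑ c', ∑ c, if f c = l ∧ f c' = l' then Z l g c * X c c' * star (Z l' g c') else 0 := by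
  simp only [Matrix.mul_apply, Matrix.conjTranspose_apply, hashKraus, Matrix.of_apply,
    Finset.sum_mul]
  refine Finset.sum_congr rfl fun c' _ => Finset.sum_congr rfl fun c _ => ?_
  by_cases h : f c = l <;> by_cases h' : f c' = l' <;> simp [h, h']

/-- Each Kraus operator maps a basis vector to a multiple of a basis vector, hence preserves
diagonality. -/
theorem hashKraus_mul_mul_eq_dephase {C L G : Type*} [Fintype C] [DecidableEq C] [DecidableEq L]
    (f : C → L) (Z : L → Matrix G C ℂ) (g : G) {X : Matrix C C ℂ} (hX : X = dephase X) :
    hashKraus f Z g * X * (hashKraus f Z g)ᴴ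
      = dephase (hashKraus f Z g * X * (hashKraus f Z g)ᴴ) := by
  rw [dephase_eq_iff] at hX ⊢
  intro l l' hl
  rw [hashKraus_mul_mul_apply]
  refine Finset.sum_eq_zero fun c' _ => Finset.sum_eq_zero fun c _ => ?_
  split_ifs with h
  · rw [hX c c' fun hc => hl (by rw [← h.1, ← h.2, hc])]
    simp
  · rfl

theorem hashChannel_map {C L G : Type*} [Fintype C] [DecidableEq C] [Fintype L] [DecidableEq L]
    [Fintype G] (f : C → L) (Z : L → Matrix G C ℂ) (hZ : ∀ l, (Z l)ᴴ * Z l = 1)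
    (X : Matrix C C ℂ) :
    (hashChannel f Z hZ).map X = ∑ g, hashKraus f Z g * X * (hashKraus f Z g)ᴴ :=
  rfl

/-- On the diagonal the isometries drop out: `f` just acts on the diagonal entries. -/
theorem hashChannel_map_apply_self {C L G : Type*} [Fintype C] [DecidableEq C] [Fintype L]
    [DecidableEq L] [Fintype G] (f : C → L) (Z : L → Matrix G C ℂ)
    (hZ : ∀ l, (Z l)ᴴ * Z l = 1) (X : Matrix C C ℂ) (l : L) :
    (hashChannel f Z hZ).map X l l = ∑ c, if f c = l then X c c else 0 := by
  rw [hashChannel_map, Matrix.sum_apply]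
  simp only [hashKraus_mul_mul_apply]
  rw [Finset.sum_comm]
  refine Finset.sum_congr rfl fun c' _ => ?_
  rw [Finset.sum_comm, Finset.sum_eq_single c']
  · by_cases h : f c' = l
    · have h1 := congrFun (congrFun (hZ l) c') c'
      simp only [Matrix.mul_apply, Matrix.conjTranspose_apply, Matrix.one_apply_eq] at h1
      simp only [h, and_self, if_true]
      calc _ = (∑ g, star (Z l g c') * Z l g c') * X c' c' := by
            rw [Finset.sum_mul]
            exact Finset.sum_congr rfl fun g _ => by ring
        _ = _ := by rw [h1, one_mul]
    · simp [h]
  · intro c _ hc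
    split_ifs with h
    · have h1 := congrFun (congrFun (hZ l) c') c
      simp only [Matrix.mul_apply, Matrix.conjTranspose_apply, Matrix.one_apply_ne hc.symm] at h1
      calc _ = (∑ g, star (Z l g c') * Z l g c) * X c c' := by
            rw [Finset.sum_mul]
            exact Finset.sum_congr rfl fun g _ => by ring
        _ = _ := by rw [h1, zero_mul]
    · simp
  · simp

theorem hashChannel_isDIO {C L G : Type*} [Fintype C] [DecidableEq C] [Fintype L] [DecidableEq L]
    [Fintype G] (f : C → L) (Z : L → Matrix G C ℂ) (hZ : ∀ l, (Z l)ᴴ * Z l = 1) :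
    IsDIO (hashChannel f Z hZ) := fun X => by
  ext l l'
  by_cases hl : l = l'
  · subst hl
    simp [dephase, hashChannel_map_apply_self]
  · rw [dephase, Matrix.diagonal_apply_ne _ hl, hashChannel_map, Matrix.sum_apply]
    refine (Finset.sum_eq_zero fun g _ => ?_).symm
    exact dephase_eq_iff.1 (hashKraus_mul_mul_eq_dephase f Z g (by simp [dephase])) l l' hl

/-! ### Stability of the free classes under postprocessing -/

theorem nonempty_of_isState {B : Type*} [Fintype B] {ρ : Matrix B B ℂ} (hρ : IsState ρ) :
    Nonempty B := by
  by_contra h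
  rw [not_nonempty_iff] at h
  simpa [Matrix.trace] using hρ.2

theorem map_posSemidef {B C : Type*} [Fintype B] [Fintype C] (Λ : Channel B C)
    {X : Matrix B B ℂ} (hX : X.PosSemidef) : (Λ.map X).PosSemidef := by
  have h := Λ.completelyPositive 1 (X.submatrix Prod.fst Prod.fst) (hX.submatrix _)
  exact h.submatrix fun c => (c, 0)

theorem isState_map {B C : Type*} [Fintype B] [Fintype C] (Λ : Channel B C) {ρ : Matrix B B ℂ}
    (hρ : IsState ρ) : IsState (Λ.map ρ) :=
  ⟨map_posSemidef Λ hρ.1, (Λ.tracePreserving ρ).trans hρ.2⟩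

theorem IsDIO.isMIO {B C : Type*} [Fintype B] [DecidableEq B] [Fintype C] [DecidableEq C]
    {Λ : Channel B C} (h : IsDIO Λ) : IsMIO Λ := fun ρ hρ =>
  ⟨isState_map Λ hρ.1, by rw [h, ← hρ.2]⟩

theorem IsIncoherentOp.isMIO {B C : Type*} [Fintype B] [DecidableEq B] [Fintype C] [DecidableEq C]
    {Λ : Channel B C} (h : IsIncoherentOp Λ) : IsMIO Λ := by
  obtain ⟨k, K, hK, hI⟩ := h
  refine fun ρ hρ => ⟨isState_map Λ hρ.1, ?_⟩
  rw [dephase_eq_iff, hK]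
  intro i j hij
  rw [Matrix.sum_apply]
  exact Finset.sum_eq_zero fun l _ => dephase_eq_iff.1 (hI l ρ hρ).2 i j hij

theorem IsFree.isMIO {B C : Type*} [Fintype B] [DecidableEq B] [Fintype C] [DecidableEq C]
    {O : FreeClass} {Λ : Channel B C} (h : IsFree O Λ) : IsMIO Λ := by
  cases O with
  | mio => exact h
  | dio => exact IsDIO.isMIO h
  | io => exact IsIncoherentOp.isMIO h
  | diio => exact IsDIO.isMIO h.1

theorem IsDIO.comp {A B C : Type*} [Fintype A] [DecidableEq A] [Fintype B] [DecidableEq B]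
    [Fintype C] [DecidableEq C] {N : Channel B C} {Λ : Channel A B} (hN : IsDIO N)
    (hΛ : IsDIO Λ) : IsDIO (N.comp Λ) := fun X => by
  change dephase (N.map (Λ.map X)) = N.map (Λ.map (dephase X))
  rw [hN, hΛ]

theorem IsMIO.comp {A B C : Type*} [Fintype A] [DecidableEq A] [Fintype B] [DecidableEq B]
    [Fintype C] [DecidableEq C] {N : Channel B C} {Λ : Channel A B} (hN : IsMIO N)
    (hΛ : IsMIO Λ) : IsMIO (N.comp Λ) := fun ρ hρ => hN _ (hΛ ρ hρ)

/-- The Kraus operators may be indexed by any finite type, and positivity of their outputs is automatic. -/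
theorem isIncoherentOp_of_kraus {B C ι : Type*} [Fintype B] [DecidableEq B] [Fintype C]
    [DecidableEq C] [Fintype ι] {Λ : Channel B C} (K : ι → Matrix C B ℂ)
    (hK : ∀ X, Λ.map X = ∑ i, K i * X * (K i)ᴴ)
    (hI : ∀ (i : ι) (ρ : Matrix B B ℂ), IsIncoherentState ρ →
      K i * ρ * (K i)ᴴ = dephase (K i * ρ * (K i)ᴴ)) :
    IsIncoherentOp Λ := by
  refine ⟨Fintype.card ι, fun l => K ((Fintype.equivFin ι).symm l), fun X => ?_,
    fun l ρ hρ => ⟨hρ.1.1.mul_mul_conjTranspose_same _, hI _ ρ hρ⟩⟩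
  rw [hK, ← (Fintype.equivFin ι).symm.sum_comp]

theorem hashChannel_comp_isIncoherentOp {B C L G : Type*} [Fintype B] [DecidableEq B] [Fintype C]
    [DecidableEq C] [Fintype L] [DecidableEq L] [Fintype G] (f : C → L) (Z : L → Matrix G C ℂ)
    (hZ : ∀ l, (Z l)ᴴ * Z l = 1) {Λ : Channel B C} (hΛ : IsIncoherentOp Λ) :
    IsIncoherentOp ((hashChannel f Z hZ).comp Λ) := by
  obtain ⟨k, K, hK, hI⟩ := hΛ
  have hassoc : ∀ (g : G) (i : Fin k) (X : Matrix B B ℂ),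
      (hashKraus f Z g * K i) * X * (hashKraus f Z g * K i)ᴴ
        = hashKraus f Z g * (K i * X * (K i)ᴴ) * (hashKraus f Z g)ᴴ := fun g i X => by
    simp only [Matrix.conjTranspose_mul, Matrix.mul_assoc]
  refine isIncoherentOp_of_kraus (fun x : G × Fin k => hashKraus f Z x.1 * K x.2)
    (fun X => ?_) fun x ρ hρ => ?_
  · change (hashChannel f Z hZ).map (Λ.map X) = _
    rw [hK, hashChannel, Channel.ofKraus_map, Fintype.sum_prod_type]
    simp only [hassoc, Matrix.mul_sum, Matrix.sum_mul]
  · rw [hassoc]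
    exact hashKraus_mul_mul_eq_dephase f Z x.1 (hI x.2 ρ hρ).2

theorem IsFree.hashChannel_comp {B C L G : Type*} [Fintype B] [DecidableEq B] [Fintype C]
    [DecidableEq C] [Fintype L] [DecidableEq L] [Fintype G] (f : C → L) (Z : L → Matrix G C ℂ)
    (hZ : ∀ l, (Z l)ᴴ * Z l = 1) {O : FreeClass} {Λ : Channel B C} (hΛ : IsFree O Λ) :
    IsFree O ((hashChannel f Z hZ).comp Λ) := by
  have hN := hashChannel_isDIO f Z hZ
  cases O with
  | mio => exact hN.isMIO.comp hΛ
  | dio => exact hN.comp hΛ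
  | io => exact hashChannel_comp_isIncoherentOp f Z hZ hΛ
  | diio => exact ⟨hN.comp hΛ.1, hashChannel_comp_isIncoherentOp f Z hZ hΛ.2⟩

/-- Every class contains a channel to a one-dimensional system, namely the trace. -/
theorem exists_isFree_fin_one (B : Type*) [Fintype B] [DecidableEq B] (O : FreeClass) :
    ∃ Λ : Channel B (Fin 1), IsFree O Λ := by
  have hZ : ∀ _ : Fin 1, (1 : Matrix B B ℂ)ᴴ * 1 = 1 := fun _ => by simp
  have hD := hashChannel_isDIO (fun _ : B => (0 : Fin 1)) (fun _ => 1) hZ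
  have hI : IsIncoherentOp (hashChannel (fun _ : B => (0 : Fin 1)) (fun _ => 1) hZ) :=
    isIncoherentOp_of_kraus _ (hashChannel_map _ _ hZ) fun g _ hρ =>
      hashKraus_mul_mul_eq_dephase _ _ g hρ.2
  refine ⟨hashChannel (fun _ : B => (0 : Fin 1)) (fun _ => 1) hZ, ?_⟩
  cases O with
  | mio => exact hD.isMIO
  | dio => exact hD
  | io => exact hI
  | diio => exact ⟨hD, hI⟩

/-! ### Fidelity with the maximally coherent state -/

theorem ketbra_mul_mul_ketbra {B : Type*} [Fintype B] (v : B → ℂ) (X : Matrix B B ℂ) :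
    ketbra v * X * ketbra v = (star v ⬝ᵥ X *ᵥ v) • ketbra v := by
  rw [ketbra, Matrix.mul_assoc, Matrix.mul_vecMulVec, Matrix.vecMulVec_mul_vecMulVec,
    Matrix.vecMulVec_smul]

theorem ketbra_mul_self {B : Type*} [Fintype B] [DecidableEq B] {v : B → ℂ}
    (hv : star v ⬝ᵥ v = 1) : ketbra v * ketbra v = ketbra v := by
  have h := ketbra_mul_mul_ketbra v 1
  rwa [Matrix.mul_one, Matrix.one_mulVec, hv, one_smul] at h

theorem posSemidef_ketbra {B : Type*} [Fintype B] (v : B → ℂ) : (ketbra v).PosSemidef :=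
  Matrix.posSemidef_vecMulVec_self_star v

theorem trace_ketbra {B : Type*} [Fintype B] (v : B → ℂ) : (ketbra v).trace = star v ⬝ᵥ v := by
  rw [ketbra, Matrix.trace_vecMulVec, dotProduct_comm]

theorem sqrt_ketbra {B : Type*} [Fintype B] [DecidableEq B] {v : B → ℂ} (hv : star v ⬝ᵥ v = 1) :
    CFC.sqrt (ketbra v) = ketbra v :=
  sqrt_eq_of_mul_self (ketbra_mul_self hv) (posSemidef_ketbra v)

theorem posSemidef_ofReal_smul {B : Type*} [Fintype B] {A : Matrix B B ℂ} (hA : A.PosSemidef)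
    {a : ℝ} (ha : 0 ≤ a) : ((a : ℂ) • A).PosSemidef :=
  hA.smul (Complex.zero_le_real.2 ha)

theorem fidelity_ketbra_sq {B : Type*} [Fintype B] [DecidableEq B] {ρ : Matrix B B ℂ}
    (hρ : ρ.PosSemidef) {v : B → ℂ} (hv : star v ⬝ᵥ v = 1) :
    fidelity ρ (ketbra v) ^ 2 = (star v ⬝ᵥ ρ *ᵥ v).re := by
  obtain ⟨ha, ha'⟩ := Complex.nonneg_iff.1 (hρ.dotProduct_mulVec_nonneg v)
  have ha2 : star v ⬝ᵥ ρ *ᵥ v = ((star v ⬝ᵥ ρ *ᵥ v).re : ℂ) := by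
    apply Complex.ext <;> simp [← ha']
  rw [fidelity_eq_of_trace_eq_one hρ ((trace_ketbra v).trans hv), sqrt_ketbra hv,
    ketbra_mul_mul_ketbra, ha2]
  have h : CFC.sqrt (((star v ⬝ᵥ ρ *ᵥ v).re : ℂ) • ketbra v)
      = ((√(star v ⬝ᵥ ρ *ᵥ v).re : ℝ) : ℂ) • ketbra v := by
    refine sqrt_eq_of_mul_self ?_ (posSemidef_ofReal_smul (posSemidef_ketbra v) (Real.sqrt_nonneg _))
    rw [Matrix.smul_mul, Matrix.mul_smul, ketbra_mul_self hv, smul_smul, ← Complex.ofReal_mul,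
      Real.mul_self_sqrt ha]
  rw [h, Matrix.trace_smul, trace_ketbra, hv, smul_eq_mul, mul_one, Complex.ofReal_re,
    Real.sq_sqrt ha, Complex.ofReal_re]

/-- The coordinates of the maximally coherent state vector. -/
noncomputable def maxCoherentVec (C : Type*) [Fintype C] : C → ℂ :=
  fun _ => ((1 / √(Fintype.card C) : ℝ) : ℂ)

theorem maxCoherentVec_mul_self (C : Type*) [Fintype C] (c : C) :
    maxCoherentVec C c * maxCoherentVec C c = (Fintype.card C : ℂ)⁻¹ := by
  rw [maxCoherentVec, ← Complex.ofReal_mul, div_mul_div_comm, Real.mul_self_sqrt (by positivity)]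
  simp

theorem star_maxCoherentVec (C : Type*) [Fintype C] :
    star (maxCoherentVec C) = maxCoherentVec C := by
  ext c
  simp [maxCoherentVec]

theorem star_maxCoherentVec_dotProduct_self (C : Type*) [Fintype C] [Nonempty C] :
    star (maxCoherentVec C) ⬝ᵥ maxCoherentVec C = 1 := by
  rw [star_maxCoherentVec, dotProduct]
  simp only [maxCoherentVec_mul_self]
  simp

theorem fidelity_maxCoherent_sq {C : Type*} [Fintype C] [DecidableEq C] [Nonempty C]
    {ρ : Matrix C C ℂ} (hρ : ρ.PosSemidef) :
    fidelity ρ (maxCoherent C) ^ 2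
      = (star (maxCoherentVec C) ⬝ᵥ ρ *ᵥ maxCoherentVec C).re :=
  fidelity_ketbra_sq hρ (star_maxCoherentVec_dotProduct_self C)

/-- The marginal of a pure state is tested against `w` by projecting the first system onto `w`. -/
theorem star_dotProduct_traceRight_ketbra_mulVec {C E : Type*} [Fintype C] [Fintype E]
    (φ : C × E → ℂ) (w : C → ℂ) :
    star w ⬝ᵥ traceRight (ketbra φ) *ᵥ w
      = ((∑ x, ‖∑ c, star (w c) * φ (c, x)‖ ^ 2 : ℝ) : ℂ) := by
  have h : ∀ z : ℂ, ((‖z‖ ^ 2 : ℝ) : ℂ) = z * star z := fun z => by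
    rw [Complex.star_def, Complex.mul_conj, Complex.normSq_eq_norm_sq]
  simp only [Complex.ofReal_sum, h, dotProduct, Matrix.mulVec, traceRight, ketbra, Matrix.of_apply,
    Matrix.vecMulVec_apply, Pi.star_apply, Finset.sum_mul, Finset.mul_sum, star_sum, star_mul',
    star_star]
  rw [Finset.sum_congr rfl fun c _ => Finset.sum_comm, Finset.sum_comm]
  refine Finset.sum_congr rfl fun x _ => ?_
  rw [Finset.sum_comm]
  exact Finset.sum_congr rfl fun c _ => Finset.sum_congr rfl fun c' _ => by ring

/-! ### The dimension bound -/

/-- The pinching inequality `ρ ≤ d Δ(ρ)`, as `Δ(ρ) - ρ / d` is the Hadamard product of `ρ` with the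
projection `1 - Ψ`. -/
theorem posSemidef_dephase_sub {B : Type*} [Fintype B] [DecidableEq B] {ρ : Matrix B B ℂ}
    (hρ : ρ.PosSemidef) : (dephase ρ - (Fintype.card B : ℂ)⁻¹ • ρ).PosSemidef := by
  cases isEmpty_or_nonempty B
  · rw [Subsingleton.elim (dephase ρ - (Fintype.card B : ℂ)⁻¹ • ρ) 0]
    exact Matrix.PosSemidef.zero
  have hv := star_maxCoherentVec_dotProduct_self B
  have hQ : (1 - ketbra (maxCoherentVec B)).PosSemidef := by
    have h : 1 - ketbra (maxCoherentVec B)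
        = (1 - ketbra (maxCoherentVec B))ᴴ * (1 - ketbra (maxCoherentVec B)) := by
      rw [Matrix.conjTranspose_sub, Matrix.conjTranspose_one,
        (posSemidef_ketbra _).isHermitian.eq, Matrix.mul_sub, Matrix.sub_mul, Matrix.sub_mul,
        ketbra_mul_self hv]
      simp
    rw [h]
    exact Matrix.posSemidef_conjTranspose_mul_self _
  suffices h : dephase ρ - (Fintype.card B : ℂ)⁻¹ • ρ
      = ρ.hadamard (1 - ketbra (maxCoherentVec B)) from h ▸ hρ.hadamard hQ
  ext b b'
  have h2 : ketbra (maxCoherentVec B) b b' = (Fintype.card B : ℂ)⁻¹ := by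
    rw [ketbra, Matrix.vecMulVec_apply, star_maxCoherentVec]
    exact maxCoherentVec_mul_self B b
  simp only [Matrix.sub_apply, Matrix.smul_apply, Matrix.hadamard_apply, smul_eq_mul, h2, dephase,
    Matrix.diagonal_apply, Matrix.diag_apply, Matrix.one_apply]
  split_ifs with h
  · subst h; ring
  · ring

theorem fidelity_map_maxCoherent_sq_le {B C : Type*} [Fintype B] [DecidableEq B] [Fintype C]
    [DecidableEq C] [Nonempty C] {Λ : Channel B C} (hΛ : IsMIO Λ) {ρ : Matrix B B ℂ}
    (hρ : IsState ρ) :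
    fidelity (Λ.map ρ) (maxCoherent C) ^ 2 ≤ Fintype.card B / Fintype.card C := by
  have hB : Nonempty B := nonempty_of_isState hρ
  rw [fidelity_maxCoherent_sq (map_posSemidef Λ hρ.1)]
  have hdiag : IsIncoherentState (dephase ρ) := by
    refine ⟨⟨?_, ?_⟩, by simp [dephase]⟩
    · exact Matrix.PosSemidef.diagonal fun b => hρ.1.diag_nonneg
    · rw [← hρ.2]; simp [dephase, Matrix.trace]
  obtain ⟨⟨_, htr⟩, hD⟩ := hΛ _ hdiag
  have h1 : star (maxCoherentVec C) ⬝ᵥ Λ.map (dephase ρ) *ᵥ maxCoherentVec C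
      = (Fintype.card C : ℂ)⁻¹ := by
    rw [hD, dephase, star_maxCoherentVec, dotProduct]
    simp only [Matrix.mulVec_diagonal]
    calc _ = (Fintype.card C : ℂ)⁻¹ * ∑ c, (Λ.map (dephase ρ)).diag c := by
          rw [Finset.mul_sum]
          refine Finset.sum_congr rfl fun c _ => ?_
          rw [← maxCoherentVec_mul_self C c]
          ring
      _ = _ := by
          change _ * (Λ.map (dephase ρ)).trace = _
          rw [htr, mul_one]
  have h2 := (map_posSemidef Λ (posSemidef_dephase_sub hρ.1)).dotProduct_mulVec_nonneg
    (maxCoherentVec C)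
  rw [map_sub, map_smul, Matrix.sub_mulVec, dotProduct_sub, h1, Matrix.smul_mulVec,
    dotProduct_smul] at h2
  have h3 := (Complex.nonneg_iff.1 h2).1
  have hc : ∀ m : ℕ, (m : ℂ)⁻¹ = (((m : ℝ)⁻¹ : ℝ) : ℂ) := fun m => by simp
  rw [hc, hc, Complex.sub_re, smul_eq_mul, Complex.re_ofReal_mul, Complex.ofReal_re] at h3
  have hd : (0 : ℝ) < Fintype.card B := by exact_mod_cast Fintype.card_pos
  rw [div_eq_mul_inv]
  have h4 := mul_le_mul_of_nonneg_left (sub_nonneg.1 h3) hd.le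
  rwa [← mul_assoc, mul_inv_cancel₀ hd.ne', one_mul] at h4

/-! ### The security distance is attained -/

theorem isState_maxMixed_kronecker (L : Type*) {R : Type*} [Fintype L] [DecidableEq L] [Nonempty L]
    [Fintype R] {σ : Matrix R R ℂ} (hσ : IsState σ) : IsState (maxMixed L ⊗ₖ σ) := by
  refine ⟨Matrix.PosSemidef.kronecker ?_ hσ.1, ?_⟩
  · exact Matrix.PosSemidef.one.smul (by positivity)
  · rw [Matrix.trace_kronecker, hσ.2, maxMixed, Matrix.trace_smul, Matrix.trace_one]
    simp

theorem isState_ketbra {R : Type*} [Fintype R] {v : R → ℂ} (hv : star v ⬝ᵥ v = 1) :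
    IsState (ketbra v) :=
  ⟨posSemidef_ketbra v, (trace_ketbra v).trans hv⟩

theorem exists_isState (R : Type*) [Fintype R] [Nonempty R] : ∃ σ : Matrix R R ℂ, IsState σ :=
  ⟨_, isState_ketbra (star_maxCoherentVec_dotProduct_self R)⟩

theorem trace_conjTranspose_mul_self {R S : Type*} [Fintype R] [Fintype S] (Q : Matrix S R ℂ) :
    (Qᴴ * Q).trace = ((∑ i, ∑ j, ‖Q j i‖ ^ 2 : ℝ) : ℂ) := by
  simp only [Matrix.trace, Matrix.diag, Matrix.mul_apply, Matrix.conjTranspose_apply,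
    Complex.ofReal_sum]
  refine Finset.sum_congr rfl fun i _ => Finset.sum_congr rfl fun j _ => ?_
  rw [mul_comm, Complex.star_def, Complex.mul_conj, Complex.normSq_eq_norm_sq]

/-- The states are the image of a sphere under `Q ↦ Qᴴ Q`. -/
theorem isCompact_isState (R : Type*) [Fintype R] [DecidableEq R] :
    IsCompact {σ : Matrix R R ℂ | IsState σ} := by
  have hS : IsCompact {Q : Matrix R R ℂ | ∑ i, ∑ j, ‖Q j i‖ ^ 2 = 1} := by
    have hK : IsCompact {Q : Matrix R R ℂ | ∀ i, Q i ∈ {r : R → ℂ | ∀ j, r j ∈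
        Metric.closedBall (0 : ℂ) 1}} :=
      isCompact_pi_infinite fun _ => isCompact_pi_infinite fun _ => isCompact_closedBall _ _
    refine hK.of_isClosed_subset (isClosed_eq (by fun_prop) continuous_const) fun Q hQ j i => ?_
    rw [mem_closedBall_zero_iff, ← sq_le_one_iff₀ (norm_nonneg _), ← show _ = _ from hQ]
    exact (Finset.single_le_sum (f := fun j => ‖Q j i‖ ^ 2) (fun _ _ => by positivity)
      (Finset.mem_univ j)).trans (Finset.single_le_sum (f := fun i => ∑ j, ‖Q j i‖ ^ 2)
        (fun _ _ => by positivity) (Finset.mem_univ i))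
  convert hS.image (f := fun Q => Qᴴ * Q) (by fun_prop) using 1
  ext σ
  constructor
  · rintro ⟨h1, h2⟩
    refine ⟨CFC.sqrt σ, ?_, ?_⟩
    · have h3 := trace_conjTranspose_mul_self (CFC.sqrt σ)
      rw [(posSemidef_sqrt σ).isHermitian.eq, sqrt_mul_sqrt h1, h2] at h3
      exact_mod_cast h3.symm
    · change (CFC.sqrt σ)ᴴ * CFC.sqrt σ = σ
      rw [(posSemidef_sqrt σ).isHermitian.eq, sqrt_mul_sqrt h1]
  · rintro ⟨Q, hQ, rfl⟩
    refine ⟨Matrix.posSemidef_conjTranspose_mul_self Q, ?_⟩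
    rw [trace_conjTranspose_mul_self, show _ = _ from hQ, Complex.ofReal_one]

theorem continuousOn_purifiedDist_maxMixed_kronecker {L R : Type*} [Fintype L] [DecidableEq L]
    [Nonempty L] [Fintype R] [DecidableEq R] {ω : Matrix (L × R) (L × R) ℂ} (hω : ω.PosSemidef) :
    ContinuousOn (fun σ : Matrix R R ℂ => purifiedDist ω (maxMixed L ⊗ₖ σ)) {σ | IsState σ} := by
  have h1 : ContinuousOn (fun σ : Matrix R R ℂ => CFC.sqrt (maxMixed L ⊗ₖ σ)) {σ | IsState σ} := by
    refine continuousOn_matrix_sqrt.comp (Continuous.continuousOn ?_) fun σ hσ =>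
      (isState_maxMixed_kronecker L hσ).1
    exact continuous_matrix fun x y =>
      (continuous_const (y := maxMixed L x.1 y.1)).mul (continuous_id.matrix_elem x.2 y.2)
  have h2 : ContinuousOn (fun σ : Matrix R R ℂ => CFC.sqrt
      (CFC.sqrt (maxMixed L ⊗ₖ σ) * ω * CFC.sqrt (maxMixed L ⊗ₖ σ))) {σ | IsState σ} := by
    refine continuousOn_matrix_sqrt.comp ((h1.mul continuousOn_const).mul h1) fun σ _ => ?_
    have h := hω.mul_mul_conjTranspose_same (CFC.sqrt (maxMixed L ⊗ₖ σ))
    rwa [(posSemidef_sqrt _).isHermitian.eq] at h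
  have h3 : ContinuousOn (fun σ : Matrix R R ℂ => √(1 - (CFC.sqrt (CFC.sqrt (maxMixed L ⊗ₖ σ) * ω *
      CFC.sqrt (maxMixed L ⊗ₖ σ))).trace.re ^ 2)) {σ | IsState σ} := by
    have h4 : Continuous fun M : Matrix (L × R) (L × R) ℂ => √(1 - M.trace.re ^ 2) := by
      have := (continuous_id (X := Matrix (L × R) (L × R) ℂ)).matrix_trace
      exact (continuous_const.sub ((Complex.continuous_re.comp this).pow 2)).sqrt
    exact h4.comp_continuousOn h2
  refine h3.congr fun σ hσ => ?_
  simp only [purifiedDist]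
  rw [fidelity_eq_of_trace_eq_one hω (isState_maxMixed_kronecker L hσ).2]

/-- The infimum in `dSec` is a minimum, by compactness of the set of states. For empty `R` it would be the
junk value `0`. -/
theorem dSec_le_iff {L R : Type*} [Fintype L] [DecidableEq L] [Nonempty L] [Fintype R]
    [DecidableEq R] [Nonempty R] {ω : Matrix (L × R) (L × R) ℂ} (hω : ω.PosSemidef) {ε : ℝ} :
    dSec ω ≤ ε ↔ ∃ σ, IsState σ ∧ purifiedDist ω (maxMixed L ⊗ₖ σ) ≤ ε := by
  have himage : {d | ∃ σ : Matrix R R ℂ, IsState σ ∧ d = purifiedDist ω (maxMixed L ⊗ₖ σ)}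
      = (fun σ => purifiedDist ω (maxMixed L ⊗ₖ σ)) '' {σ | IsState σ} := by
    ext d
    simp only [Set.mem_ofPred_eq, Set.mem_image, eq_comm]
  constructor
  · intro h
    obtain ⟨σ, hσ, hd⟩ : dSec ω ∈ (fun σ => purifiedDist ω (maxMixed L ⊗ₖ σ)) '' {σ | IsState σ} := by
      rw [dSec, himage]
      exact ((isCompact_isState R).image_of_continuousOn
        (continuousOn_purifiedDist_maxMixed_kronecker hω)).sInf_mem
          (Set.Nonempty.image _ (exists_isState R))
    exact ⟨σ, hσ, hd.trans_le h⟩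
  · rintro ⟨σ, hσ, h⟩
    have hb : BddBelow {d | ∃ σ : Matrix R R ℂ, IsState σ ∧
        d = purifiedDist ω (maxMixed L ⊗ₖ σ)} :=
      ⟨0, by rintro _ ⟨τ, _, rfl⟩; exact Real.sqrt_nonneg _⟩
    exact (csInf_le hb ⟨σ, hσ, rfl⟩).trans h

/-! ### From distillation to extraction -/

theorem hashLeft_dephaseLeft_ketbra {C L E : Type*} [Fintype C] [DecidableEq C] [DecidableEq L]
    (f : C → L) (φ : C × E → ℂ) :
    hashLeft f (dephaseLeft (ketbra φ))
      = ∑ c, Matrix.single (f c) (f c) (1 : ℂ) ⊗ₖ ketbra fun x => φ (c, x) := by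
  refine Finset.sum_congr rfl fun c _ => ?_
  congr 1
  ext x y
  simp [dephaseLeft, ketbra, Matrix.vecMulVec_apply]

theorem posSemidef_hashLeft_dephaseLeft_ketbra {C L E : Type*} [Fintype C] [DecidableEq C]
    [Fintype L] [DecidableEq L] [Fintype E] (f : C → L) (φ : C × E → ℂ) :
    (hashLeft f (dephaseLeft (ketbra φ))).PosSemidef := by
  classical
  rw [hashLeft_dephaseLeft_ketbra]
  refine Matrix.posSemidef_sum _ fun c _ => Matrix.PosSemidef.kronecker ?_ (posSemidef_ketbra _)
  rw [← Matrix.diagonal_single]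
  refine Matrix.PosSemidef.diagonal fun l => ?_
  by_cases h : l = f c
  · subst h; simp
  · simp [h]

theorem sqrt_maxMixed_kronecker (L : Type*) {R : Type*} [Fintype L] [DecidableEq L] [Fintype R]
    [DecidableEq R] {σ : Matrix R R ℂ} (hσ : σ.PosSemidef) :
    CFC.sqrt (maxMixed L ⊗ₖ σ)
      = ((1 / √(Fintype.card L) : ℝ) : ℂ) • ((1 : Matrix L L ℂ) ⊗ₖ CFC.sqrt σ) := by
  refine sqrt_eq_of_mul_self ?_ (posSemidef_ofReal_smul
    (Matrix.PosSemidef.one.kronecker (posSemidef_sqrt σ)) (by positivity))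
  rw [Matrix.smul_mul, Matrix.mul_smul, smul_smul, ← Matrix.mul_kronecker_mul, sqrt_mul_sqrt hσ,
    Matrix.one_mul, maxMixed, Matrix.smul_kronecker, ← Complex.ofReal_mul, div_mul_div_comm,
    Real.mul_self_sqrt (by positivity)]
  simp

/-- The fidelity of the dephased state `∑ c, |c⟩⟨c| ⊗ |φ_c⟩⟨φ_c|` with `π ⊗ |θ⟩⟨θ|`. -/
theorem fidelity_dephaseLeft_ketbra {C E : Type*} [Fintype C] [DecidableEq C] [Nonempty C]
    [Fintype E] [DecidableEq E] (φ : C × E → ℂ) {θ : E → ℂ} (hθ : star θ ⬝ᵥ θ = 1) :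
    fidelity (hashLeft id (dephaseLeft (ketbra φ))) (maxMixed C ⊗ₖ ketbra θ)
      = ∑ c, 1 / √(Fintype.card C) * ‖star θ ⬝ᵥ fun x => φ (c, x)‖ := by
  set s : ℝ := 1 / √(Fintype.card C) with hs
  have hs0 : 0 ≤ s := by positivity
  set a : C → ℝ := fun c => s * ‖star θ ⬝ᵥ fun x => φ (c, x)‖ with ha
  have ha0 : ∀ c, 0 ≤ a c := fun c => by positivity
  rw [fidelity_eq_of_trace_eq_one (posSemidef_hashLeft_dephaseLeft_ketbra _ _)
    (isState_maxMixed_kronecker C (isState_ketbra hθ)).2,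
    sqrt_maxMixed_kronecker C (posSemidef_ketbra θ), sqrt_ketbra hθ]
  have h : CFC.sqrt (((s : ℂ) • ((1 : Matrix C C ℂ) ⊗ₖ ketbra θ)) *
      hashLeft id (dephaseLeft (ketbra φ)) * ((s : ℂ) • ((1 : Matrix C C ℂ) ⊗ₖ ketbra θ)))
      = Matrix.diagonal (fun c => (a c : ℂ)) ⊗ₖ ketbra θ := by
    refine sqrt_eq_of_mul_self ?_ ?_
    · rw [hashLeft_dephaseLeft_ketbra, ← Matrix.mul_kronecker_mul, ketbra_mul_self hθ,
        Matrix.diagonal_mul_diagonal, Matrix.mul_sum, Matrix.sum_mul]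
      have hc : ∀ c, ((s : ℂ) • ((1 : Matrix C C ℂ) ⊗ₖ ketbra θ)) *
          (Matrix.single (id c) (id c) (1 : ℂ) ⊗ₖ ketbra fun x => φ (c, x)) *
          ((s : ℂ) • ((1 : Matrix C C ℂ) ⊗ₖ ketbra θ))
          = ((a c : ℂ) * a c) • (Matrix.single c c (1 : ℂ) ⊗ₖ ketbra θ) := fun c => by
        have hk : star θ ⬝ᵥ (ketbra fun x => φ (c, x)) *ᵥ θ
            = ((‖star θ ⬝ᵥ fun x => φ (c, x)‖ ^ 2 : ℝ) : ℂ) := by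
          rw [ketbra, Matrix.vecMulVec_mulVec, dotProduct_smul, ← Complex.normSq_eq_norm_sq,
            ← Complex.mul_conj, ← Complex.star_def, ← Matrix.star_dotProduct_star]
          simp [dotProduct_comm]
        rw [Matrix.smul_mul, Matrix.smul_mul, Matrix.mul_smul, smul_smul,
          ← Matrix.mul_kronecker_mul, ← Matrix.mul_kronecker_mul, Matrix.one_mul, Matrix.mul_one,
          ketbra_mul_mul_ketbra, hk, Matrix.kronecker_smul, smul_smul]
        congr 1
        simp only [ha]
        push_cast
        ring
      rw [Finset.sum_congr rfl fun c _ => hc c]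
      ext ⟨c, x⟩ ⟨c', x'⟩
      simp only [Matrix.kronecker_apply, Matrix.sum_apply, Matrix.smul_apply, Matrix.diagonal_apply,
        Matrix.single_apply, smul_eq_mul]
      rw [Finset.sum_eq_single c]
      · split_ifs with h1 h2 h2
        · ring
        · exact absurd h1 (by simpa using h2)
        · exact absurd h2.2 h1
        · ring
      · intro b _ hb
        simp [hb]
      · simp
    · exact Matrix.PosSemidef.kronecker (Matrix.PosSemidef.diagonal fun c =>
        Complex.zero_le_real.2 (ha0 c)) (posSemidef_ketbra θ)
  rw [h, Matrix.trace_kronecker, trace_ketbra, hθ, mul_one, Matrix.trace_diagonal,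
    ← Complex.ofReal_sum, Complex.ofReal_re]

/-- If the marginal of `φ` on `C` is close to the maximally coherent state, then `C` after dephasing is
close to being uniform and independent of `E`. The state `θ` of `E` is, up to normalization, the
projection of `φ` onto the maximally coherent vector. -/
theorem exists_isState_fidelity_le {C E : Type*} [Fintype C] [DecidableEq C] [Nonempty C]
    [Fintype E] [DecidableEq E] [Nonempty E] (φ : C × E → ℂ)
    (hφ : (traceRight (ketbra φ)).PosSemidef) :
    ∃ σ : Matrix E E ℂ, IsState σ ∧ fidelity (traceRight (ketbra φ)) (maxCoherent C) ^ 2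
      ≤ fidelity (hashLeft id (dephaseLeft (ketbra φ))) (maxMixed C ⊗ₖ σ) ^ 2 := by
  set s : ℝ := 1 / √(Fintype.card C) with hs
  have hs0 : 0 ≤ s := by positivity
  set v : E → ℂ := fun x => ∑ c, (s : ℂ) * φ (c, x) with hv
  set N : ℝ := ∑ x, ‖v x‖ ^ 2 with hN
  have hN0 : 0 ≤ N := by positivity
  have hF : fidelity (traceRight (ketbra φ)) (maxCoherent C) ^ 2 = N := by
    rw [fidelity_maxCoherent_sq hφ, star_dotProduct_traceRight_ketbra_mulVec, Complex.ofReal_re]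
    simp only [hN, hv, maxCoherentVec, Complex.star_def, Complex.conj_ofReal, ← hs]
  rw [hF]
  -- If `v = 0` it cannot be normalized, but then the left-hand side vanishes and any state will do.
  rcases hN0.eq_or_lt with h0 | hpos
  · obtain ⟨σ, hσ⟩ := exists_isState E
    exact ⟨σ, hσ, h0 ▸ sq_nonneg _⟩
  have hvv : star v ⬝ᵥ v = (N : ℂ) := by
    rw [dotProduct, hN, Complex.ofReal_sum]
    refine Finset.sum_congr rfl fun x _ => ?_
    rw [Pi.star_apply, mul_comm, Complex.star_def, Complex.mul_conj, Complex.normSq_eq_norm_sq]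
  have hsq : √N ≠ 0 := (Real.sqrt_pos.2 hpos).ne'
  set t : ℝ := (√N)⁻¹ with ht
  have htN : t * N = √N := by
    rw [ht, ← div_eq_inv_mul, Real.div_sqrt]
  have hst : star ((t : ℂ) • v) = (t : ℂ) • star v := by
    rw [star_smul, Complex.star_def, Complex.conj_ofReal]
  have hθ : star ((t : ℂ) • v) ⬝ᵥ ((t : ℂ) • v) = 1 := by
    rw [hst, smul_dotProduct, dotProduct_smul, hvv, smul_eq_mul, smul_eq_mul, ← Complex.ofReal_mul,
      htN, ← Complex.ofReal_mul, ht, inv_mul_cancel₀ hsq, Complex.ofReal_one]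
  refine ⟨ketbra ((t : ℂ) • v), isState_ketbra hθ, ?_⟩
  have hle : √N ≤ fidelity (hashLeft id (dephaseLeft (ketbra φ)))
      (maxMixed C ⊗ₖ ketbra ((t : ℂ) • v)) := by
    rw [fidelity_dephaseLeft_ketbra φ hθ]
    have h1 : star ((t : ℂ) • v) ⬝ᵥ v = ((√N : ℝ) : ℂ) := by
      rw [hst, smul_dotProduct, hvv, smul_eq_mul, ← Complex.ofReal_mul, htN]
    have h2 : star ((t : ℂ) • v) ⬝ᵥ v
        = ∑ c, (s : ℂ) * (star ((t : ℂ) • v) ⬝ᵥ fun x => φ (c, x)) := by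
      simp only [dotProduct, hv, Finset.mul_sum]
      rw [Finset.sum_comm]
      exact Finset.sum_congr rfl fun c _ => Finset.sum_congr rfl fun x _ => by ring
    calc √N = ‖star ((t : ℂ) • v) ⬝ᵥ v‖ := by
          rw [h1, Complex.norm_real, Real.norm_of_nonneg (Real.sqrt_nonneg _)]
      _ ≤ ∑ c, ‖(s : ℂ) * (star ((t : ℂ) • v) ⬝ᵥ fun x => φ (c, x))‖ := by
          rw [h2]
          exact norm_sum_le _ _
      _ = _ := by
          refine Finset.sum_congr rfl fun c _ => ?_
          rw [norm_mul, Complex.norm_real, Real.norm_of_nonneg hs0]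
  calc N = √N ^ 2 := (Real.sq_sqrt hN0).symm
    _ ≤ _ := pow_le_pow_left₀ (Real.sqrt_nonneg _) hle 2

/-! ### From extraction to distillation -/

/-- A factor `A` of the protocol output `A Aᴴ`: it purifies the output by a copy of the system `C`. -/
def hashFactor {C L E : Type*} [DecidableEq L] (f : C → L) (φ : C × E → ℂ) : Matrix (L × E) C ℂ :=
  Matrix.of fun x c => if f c = x.1 then φ (c, x.2) else 0

theorem hashFactor_mul_conjTranspose {C L E : Type*} [Fintype C] [DecidableEq C] [DecidableEq L]
    (f : C → L) (φ : C × E → ℂ) :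
    hashFactor f φ * (hashFactor f φ)ᴴ = hashLeft f (dephaseLeft (ketbra φ)) := by
  rw [hashLeft_dephaseLeft_ketbra]
  ext ⟨l, x⟩ ⟨l', x'⟩
  simp only [Matrix.mul_apply, Matrix.conjTranspose_apply, hashFactor, Matrix.of_apply,
    Matrix.sum_apply, Matrix.kronecker_apply, Matrix.single_apply, ketbra, Matrix.vecMulVec_apply,
    Pi.star_apply]
  refine Finset.sum_congr rfl fun c _ => ?_
  by_cases h : f c = l
  · subst h
    by_cases h' : f c = l'
    · subst h'; simp
    · simp [h']
  · simp [h]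

/-- The blocks of a contraction, conjugated entrywise, are contractions. -/
theorem posSemidef_one_sub_block {C L E : Type*} [Fintype C] [DecidableEq C] [Fintype L]
    [DecidableEq L] [Fintype E] {W : Matrix (L × E) C ℂ} (hW : (1 - Wᴴ * W).PosSemidef) (l : L) :
    (1 - (Matrix.of fun y c => star (W (l, y) c))ᴴ *
      (Matrix.of fun y c => star (W (l, y) c) : Matrix E C ℂ)).PosSemidef := by
  set V : L → Matrix E C ℂ := fun l => Matrix.of fun y c => W (l, y) c
  have hsum : Wᴴ * W = ∑ l, (V l)ᴴ * V l := by
    ext c c'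
    simp [V, Matrix.sum_apply, Matrix.mul_apply, Fintype.sum_prod_type]
  have h1 : (1 - (V l)ᴴ * V l).PosSemidef := by
    have h2 : 1 - (V l)ᴴ * V l
        = (1 - Wᴴ * W) + ∑ k ∈ Finset.univ.erase l, (V k)ᴴ * V k := by
      rw [hsum, ← Finset.add_sum_erase _ _ (Finset.mem_univ l)]
      abel
    rw [h2]
    exact hW.add (Matrix.posSemidef_sum _ fun k _ => Matrix.posSemidef_conjTranspose_mul_self _)
  have h3 : 1 - (Matrix.of fun y c => star (W (l, y) c))ᴴ *
      (Matrix.of fun y c => star (W (l, y) c) : Matrix E C ℂ) = (1 - (V l)ᴴ * V l)ᵀ := by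
    rw [Matrix.transpose_sub, Matrix.transpose_one]
    congr 1
    ext c c'
    simp [V, Matrix.mul_apply, mul_comm]
  exact h3 ▸ h1.transpose

/-- A contraction `Y` is completed to the isometry with the blocks `Y` and `√(1 - Yᴴ Y)`. -/
theorem conjTranspose_fromRows_sqrt_mul_self {C E : Type*} [Fintype C] [DecidableEq C] [Fintype E]
    {Y : Matrix E C ℂ} (hY : (1 - Yᴴ * Y).PosSemidef) :
    (Matrix.fromRows Y (CFC.sqrt (1 - Yᴴ * Y)))ᴴ * Matrix.fromRows Y (CFC.sqrt (1 - Yᴴ * Y))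
      = 1 := by
  rw [Matrix.conjTranspose_fromRows_eq_fromCols_conjTranspose, Matrix.fromCols_mul_fromRows,
    (posSemidef_sqrt _).isHermitian.eq, sqrt_mul_sqrt hY]
  abel

theorem fidelity_hashChannel_maxCoherent_sq {C L E G : Type*} [Fintype C] [DecidableEq C]
    [Fintype L] [DecidableEq L] [Nonempty L] [Fintype E] [Fintype G] (f : C → L)
    (Z : L → Matrix G C ℂ) (hZ : ∀ l, (Z l)ᴴ * Z l = 1) (φ : C × E → ℂ)
    (hφ : (traceRight (ketbra φ)).PosSemidef) :
    fidelity ((hashChannel f Z hZ).map (traceRight (ketbra φ))) (maxCoherent L) ^ 2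
      = ∑ g, ∑ x, ‖∑ c, ((1 / √(Fintype.card L) : ℝ) : ℂ) * Z (f c) g c * φ (c, x)‖ ^ 2 := by
  rw [fidelity_maxCoherent_sq (map_posSemidef _ hφ), hashChannel_map, Matrix.sum_mulVec,
    dotProduct_sum, Complex.re_sum]
  refine Finset.sum_congr rfl fun g _ => ?_
  have h : star (maxCoherentVec L) ⬝ᵥ (hashKraus f Z g * traceRight (ketbra φ) *
      (hashKraus f Z g)ᴴ) *ᵥ maxCoherentVec L
      = star ((hashKraus f Z g)ᴴ *ᵥ maxCoherentVec L) ⬝ᵥ traceRight (ketbra φ) *ᵥ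
        ((hashKraus f Z g)ᴴ *ᵥ maxCoherentVec L) := by
    rw [Matrix.star_mulVec, Matrix.conjTranspose_conjTranspose, ← Matrix.dotProduct_mulVec,
      Matrix.mulVec_mulVec, Matrix.mulVec_mulVec, Matrix.mul_assoc]
  rw [h, star_dotProduct_traceRight_ketbra_mulVec, Complex.ofReal_re]
  refine Finset.sum_congr rfl fun x _ => ?_
  congr 3
  ext c
  congr 1
  simp only [Matrix.mulVec, dotProduct, Matrix.conjTranspose_apply, hashKraus, Matrix.of_apply,
    maxCoherentVec, star_sum, Complex.star_def, ite_mul, zero_mul, apply_ite (starRingEnd ℂ),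
    map_zero]
  simp [mul_comm]

/-- Uhlmann's theorem turned into a protocol: the contraction `W` of the polar decomposition decouples `C`
from `E` in each block, so that applying it coherently restores the coherence of the value of `f`. -/
theorem exists_hashChannel_fidelity_le {C L E : Type*} [Fintype C] [DecidableEq C] [Fintype L]
    [DecidableEq L] [Nonempty L] [Fintype E] [DecidableEq E] (f : C → L) (φ : C × E → ℂ)
    (hφ : (traceRight (ketbra φ)).PosSemidef) {σ : Matrix E E ℂ} (hσ : IsState σ) :
    ∃ (Z : L → Matrix (E ⊕ C) C ℂ) (hZ : ∀ l, (Z l)ᴴ * Z l = 1),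
      fidelity (hashLeft f (dephaseLeft (ketbra φ))) (maxMixed L ⊗ₖ σ) ^ 2
        ≤ fidelity ((hashChannel f Z hZ).map (traceRight (ketbra φ))) (maxCoherent L) ^ 2 := by
  set A := hashFactor f φ with hA
  set s : ℝ := 1 / √(Fintype.card L) with hs
  have hT := sqrt_maxMixed_kronecker L hσ.1
  set T := CFC.sqrt (maxMixed L ⊗ₖ σ) with hTdef
  have hTh : Tᴴ = T := (posSemidef_sqrt _).isHermitian.eq
  obtain ⟨W, hW, hWM⟩ := exists_contraction_mul_eq_sqrt (Aᴴ * T)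
  have hF : fidelity (hashLeft f (dephaseLeft (ketbra φ))) (maxMixed L ⊗ₖ σ)
      = (W * (Aᴴ * T)).trace.re := by
    rw [fidelity_eq_of_trace_eq_one (posSemidef_hashLeft_dephaseLeft_ketbra f φ)
      (isState_maxMixed_kronecker L hσ).2, ← hTdef, ← hashFactor_mul_conjTranspose, ← hA, hWM,
      Matrix.conjTranspose_mul, hTh, Matrix.conjTranspose_conjTranspose]
    simp only [Matrix.mul_assoc]
  set Q := CFC.sqrt σ with hQ
  set β : E → E → ℂ := fun y x => ∑ c, (s : ℂ) * star (W (f c, y) c) * φ (c, x) with hβ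
  -- The conjugate of the trace is linear in `φ`, whence the conjugated entries of `W` below.
  have htr : star (W * (Aᴴ * T)).trace = ∑ y, ∑ x, Q y x * β y x := by
    rw [← Matrix.trace_conjTranspose, Matrix.conjTranspose_mul, Matrix.conjTranspose_mul,
      Matrix.conjTranspose_conjTranspose, hTh, hT, Matrix.smul_mul, Matrix.smul_mul]
    have hTA : ∀ l y c, (((1 : Matrix L L ℂ) ⊗ₖ Q) * A) (l, y) c
        = if f c = l then ∑ x, Q y x * φ (c, x) else 0 := fun l y c => by
      simp only [Matrix.mul_apply, Fintype.sum_prod_type, Matrix.kronecker_apply, Matrix.one_apply,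
        hA, hashFactor, Matrix.of_apply, ite_mul, one_mul, zero_mul, mul_ite, mul_zero]
      rw [Finset.sum_eq_single l]
      · simp
      · intro k _ hk
        simp [hk.symm]
      · simp
    simp only [Matrix.trace, Matrix.diag, Matrix.smul_apply, Fintype.sum_prod_type, smul_eq_mul]
    rw [Finset.sum_comm]
    refine Finset.sum_congr rfl fun y _ => ?_
    simp only [Matrix.mul_apply (M := ((1 : Matrix L L ℂ) ⊗ₖ Q) * A), hTA,
      Matrix.conjTranspose_apply, ite_mul, zero_mul, Finset.mul_sum, hβ]
    rw [Finset.sum_comm, Finset.sum_comm (s := (Finset.univ : Finset E))]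
    refine Finset.sum_congr rfl fun c _ => ?_
    simp only [mul_ite, mul_zero, Finset.sum_ite_eq, Finset.mem_univ, if_true, Finset.sum_mul,
      Finset.mul_sum]
    exact Finset.sum_congr rfl fun x _ => by ring
  have hQ1 : ∑ p : E × E, ‖Q p.1 p.2‖ ^ 2 = 1 := by
    have h := trace_conjTranspose_mul_self Q
    rw [(posSemidef_sqrt σ).isHermitian.eq, sqrt_mul_sqrt hσ.1, hσ.2] at h
    rw [Fintype.sum_prod_type, Finset.sum_comm]
    exact_mod_cast h.symm
  have hF2 : fidelity (hashLeft f (dephaseLeft (ketbra φ))) (maxMixed L ⊗ₖ σ) ^ 2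
      ≤ ∑ y, ∑ x, ‖β y x‖ ^ 2 := by
    have h1 : fidelity (hashLeft f (dephaseLeft (ketbra φ))) (maxMixed L ⊗ₖ σ)
        ≤ ∑ p : E × E, ‖Q p.1 p.2‖ * ‖β p.1 p.2‖ := by
      rw [hF]
      calc _ ≤ ‖(W * (Aᴴ * T)).trace‖ := Complex.re_le_norm _
        _ = ‖∑ p : E × E, Q p.1 p.2 * β p.1 p.2‖ := by
            rw [← norm_star, htr, Fintype.sum_prod_type]
        _ ≤ ∑ p : E × E, ‖Q p.1 p.2 * β p.1 p.2‖ := norm_sum_le _ _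
        _ = _ := by simp only [norm_mul]
    calc _ ≤ (∑ p : E × E, ‖Q p.1 p.2‖ * ‖β p.1 p.2‖) ^ 2 :=
          pow_le_pow_left₀ (fidelity_nonneg _ _) h1 2
      _ ≤ (∑ p : E × E, ‖Q p.1 p.2‖ ^ 2) * ∑ p : E × E, ‖β p.1 p.2‖ ^ 2 :=
          Finset.sum_mul_sq_le_sq_mul_sq _ _ _
      _ = _ := by rw [hQ1, one_mul, Fintype.sum_prod_type]
  set Y : L → Matrix E C ℂ := fun l => Matrix.of fun y c => star (W (l, y) c) with hY
  refine ⟨fun l => Matrix.fromRows (Y l) (CFC.sqrt (1 - (Y l)ᴴ * Y l)),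
    fun l => conjTranspose_fromRows_sqrt_mul_self (posSemidef_one_sub_block hW l), ?_⟩
  -- Only the Kraus operators from the blocks of `W` are needed; the others contribute nonnegatively.
  rw [fidelity_hashChannel_maxCoherent_sq _ _ _ φ hφ, Fintype.sum_sum_type]
  refine hF2.trans (le_add_of_le_of_nonneg (le_of_eq ?_) (by positivity))
  rfl

/-! ### Equality of the achievable rates -/

theorem map_eq_traceRight_ketbra {B C R : Type*} [Fintype B] [DecidableEq B] [Fintype C]
    [Fintype R] {Λ : Channel B C} (S : Stinespring Λ) {ψ : B × R → ℂ} {ρ : Matrix B B ℂ}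
    (hψ : IsPurification ψ ρ) : Λ.map ρ = traceRight (ketbra (applyIsometry S.U ψ)) := by
  rw [S.map_eq, ← hψ]
  ext c c'
  simp only [traceRight, ketbra, applyIsometry, Matrix.of_apply, Matrix.mul_apply,
    Matrix.conjTranspose_apply, Matrix.vecMulVec_apply, Pi.star_apply, Fintype.sum_prod_type,
    star_sum, star_mul', Finset.sum_mul, Finset.mul_sum]
  refine Finset.sum_congr rfl fun e _ => ?_
  rw [Finset.sum_congr rfl fun b _ => Finset.sum_comm, Finset.sum_comm]
  refine Finset.sum_congr rfl fun r _ => ?_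
  exact Finset.sum_congr rfl fun b _ => Finset.sum_congr rfl fun b' _ => by ring

theorem nonempty_of_isState_traceRight {C E : Type*} [Fintype C] [Fintype E]
    {M : Matrix (C × E) (C × E) ℂ} (h : IsState (traceRight M)) : Nonempty E := by
  by_contra hE
  rw [not_nonempty_iff] at hE
  simpa [Matrix.trace, traceRight] using h.2

theorem distillationRates_eq {B : Type*} [Fintype B] [DecidableEq B] {ρ : Matrix B B ℂ}
    (hρ : IsState ρ) {ε : ℝ} (hε : 0 ≤ ε) (O : FreeClass) {R : Type*} [Fintype R] [DecidableEq R]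
    {ψ : B × R → ℂ} (hψ : IsPurification ψ ρ)
    (S : ∀ (n : ℕ) (Λ : Channel B (Fin n)), Stinespring Λ) :
    distillationRates O ε ρ
      = {x | ∃ (n : ℕ) (Λ : Channel B (Fin n)), IsFree O Λ ∧ x ∈ extractionRates (S n Λ) ε ψ} := by
  ext x
  constructor
  · rintro ⟨n, Λ, hΛ, hP, rfl⟩
    refine ⟨n, Λ, hΛ, n, id, ?_, rfl⟩
    have hst := isState_map Λ hρ
    -- Trace preservation excludes `n = 0`.
    have hn : Nonempty (Fin n) := nonempty_of_isState hst
    rw [map_eq_traceRight_ketbra (S n Λ) hψ] at hst hP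
    have hE := nonempty_of_isState_traceRight hst
    obtain ⟨σ, hσ, hle⟩ := exists_isState_fidelity_le _ hst.1
    rw [purifiedDist_le_iff hε] at hP
    exact (dSec_le_iff (posSemidef_hashLeft_dephaseLeft_ketbra _ _)).2
      ⟨σ, hσ, (purifiedDist_le_iff hε).2 (hP.trans hle)⟩
  · rintro ⟨n, Λ, hΛ, m, f, hd, rfl⟩
    have hst := isState_map Λ hρ
    have hn : Nonempty (Fin n) := nonempty_of_isState hst
    have hm : Nonempty (Fin m) := hn.map f
    have heq := map_eq_traceRight_ketbra (S n Λ) hψ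
    rw [heq] at hst
    have hE := nonempty_of_isState_traceRight hst
    obtain ⟨σ, hσ, hP⟩ := (dSec_le_iff (posSemidef_hashLeft_dephaseLeft_ketbra _ _)).1 hd
    obtain ⟨Z, hZ, hle⟩ := exists_hashChannel_fidelity_le f _ hst.1 hσ
    refine ⟨m, (hashChannel f Z hZ).comp Λ, hΛ.hashChannel_comp f Z hZ, ?_, rfl⟩
    change purifiedDist ((hashChannel f Z hZ).map (Λ.map ρ)) _ ≤ ε
    rw [purifiedDist_le_iff hε] at hP ⊢
    rw [heq]
    exact hP.trans hle

/-- The trace is a distillation protocol of rate `0` without error. -/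
theorem distillationRates_nonempty {B : Type*} [Fintype B] [DecidableEq B] {ρ : Matrix B B ℂ}
    (hρ : IsState ρ) {ε : ℝ} (hε : 0 ≤ ε) (O : FreeClass) : (distillationRates O ε ρ).Nonempty := by
  obtain ⟨Λ, hΛ⟩ := exists_isFree_fin_one B O
  refine ⟨_, 1, Λ, hΛ, ?_, rfl⟩
  have h := (Λ.tracePreserving ρ).trans hρ.2
  rw [purifiedDist_le_iff hε, fidelity_maxCoherent_sq (map_posSemidef Λ hρ.1)]
  have h1 : star (maxCoherentVec (Fin 1)) ⬝ᵥ Λ.map ρ *ᵥ maxCoherentVec (Fin 1) = 1 := by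
    rw [← h]
    simp [maxCoherentVec, Matrix.mulVec, dotProduct, Matrix.trace]
  rw [h1, Complex.one_re]
  linarith [sq_nonneg ε]

/-- By the dimension bound, `n ≤ d / (1 - ε ^ 2)` for every achievable `n`. -/
theorem distillationRates_finite {B : Type*} [Fintype B] [DecidableEq B] {ρ : Matrix B B ℂ}
    (hρ : IsState ρ) {ε : ℝ} (hε : 0 ≤ ε) (hε1 : ε < 1) (O : FreeClass) :
    (distillationRates O ε ρ).Finite := by
  have hpos : 0 < 1 - ε ^ 2 := by nlinarith
  refine ((Set.finite_Iic ⌊(Fintype.card B : ℝ) / (1 - ε ^ 2)⌋₊).image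
    fun n : ℕ => ((Real.logb 2 n : ℝ) : EReal)).subset ?_
  rintro _ ⟨n, Λ, hΛ, hP, rfl⟩
  refine ⟨n, Nat.le_floor ?_, rfl⟩
  have hn : Nonempty (Fin n) := nonempty_of_isState (isState_map Λ hρ)
  have hn0 : (0 : ℝ) < n := by exact_mod_cast Fin.pos_iff_nonempty.2 hn
  have h := ((purifiedDist_le_iff hε).1 hP).trans (fidelity_map_maxCoherent_sq_le hΛ.isMIO hρ)
  rw [Fintype.card_fin, le_div_iff₀ hn0] at h
  rw [le_div_iff₀ hpos]
  linarith

theorem extractableRandomness_eq_sSup {B R : Type*} [Fintype B] [DecidableEq B] [Fintype R]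
    [DecidableEq R] (O : FreeClass) (ε : ℝ) (ψ : B × R → ℂ)
    (S : ∀ (n : ℕ) (Λ : Channel B (Fin n)), Stinespring Λ) :
    extractableRandomness O ε ψ S
      = sSup {x | ∃ (n : ℕ) (Λ : Channel B (Fin n)), IsFree O Λ ∧
          x ∈ extractionRates (S n Λ) ε ψ} := by
  apply le_antisymm
  · refine sSup_le ?_
    rintro _ ⟨n, Λ, hΛ, rfl⟩
    exact sSup_le_sSup fun x hx => ⟨n, Λ, hΛ, hx⟩
  · refine sSup_le ?_
    rintro x ⟨n, Λ, hΛ, hx⟩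
    exact (le_sSup hx).trans (le_sSup ⟨n, Λ, hΛ, rfl⟩)

end Coherence

theorem theorem1 {B : Type*} [Fintype B] [DecidableEq B]
    (ρ : Matrix B B ℂ) (hρ : Coherence.IsState ρ)
    (ε : ℝ) (hε0 : 0 ≤ ε) (hε1 : ε ≤ 1) (O : Coherence.FreeClass)
    {R : Type*} [Fintype R] [DecidableEq R]
    (ψ : B × R → ℂ) (hψ : Coherence.IsPurification ψ ρ)
    (S : ∀ (n : ℕ) (Λ : Coherence.Channel B (Fin n)), Coherence.Stinespring Λ) :
    Coherence.distillableCoherence O ε ρ = Coherence.extractableRandomness O ε ψ S ∧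
    (ε < 1 →
      IsGreatest (Coherence.distillationRates O ε ρ) (Coherence.distillableCoherence O ε ρ) ∧
      ∃ (n : ℕ) (Λ : Coherence.Channel B (Fin n)), Coherence.IsFree O Λ ∧
        Coherence.extractableRandomness O ε ψ S ∈ Coherence.extractionRates (S n Λ) ε ψ) := by
  have hrates := Coherence.distillationRates_eq hρ hε0 O hψ S
  have heq : Coherence.distillableCoherence O ε ρ = Coherence.extractableRandomness O ε ψ S := by
    rw [Coherence.distillableCoherence, hrates, Coherence.extractableRandomness_eq_sSup]
  refine ⟨heq, fun hlt => ?_⟩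
  have hmem : Coherence.distillableCoherence O ε ρ ∈ Coherence.distillationRates O ε ρ :=
    (Coherence.distillationRates_nonempty hρ hε0 O).csSup_mem
      (Coherence.distillationRates_finite hρ hε0 hlt O)
  refine ⟨⟨hmem, fun x hx => le_sSup hx⟩, ?_⟩
  rw [heq, hrates] at hmem
  exact hmem
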